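/- Let $d\in\mathbb{N}$, let $H=(H_1,\dots,H_d)^\top$ with all $H_j>0$, and let $X=(X(t))_{t\in\mathbb{R}^d}$ be a real-valued, strictly stationary random field with finite second moments. Write $\mathbb{R}_+=(0,\infty)$ and define the (generalised) Lamperti transform $Y=(Y(t))_{t\in\mathbb{R}_+^d}$ of $X$ by $$Y(t)=\Big(\prod_{j=1}^d t_j^{H_j}\Big)\,X(\log t_1,\dots,\log t_d),\qquad t\in\mathbb{R}_+^d .$$ Suppose that $Y$ has second-order translation-invariant increments, that is, $$\mathbb{E}\big[(Y(t+h)-Y(t))^2\big]=\mathbb{E}\big[Y(h)^2\big]\qquad\text{for all } t,h\in\mathbb{R}_+^d .$$ Then, for all $s,t\in\mathbb{R}_+^d$, $$\operatorname{Cov}(Y(t),Y(s))=\frac12\Big[\prod_{j=1}^d t_j^{2H_j}+\prod_{j=1}^d s_j^{2H_j}-\prod_{j=1}^d |t_j-s_j|^{2H_j}\Big]\operatorname{Var}(X(0)).$$ Moreover, if $\operatorname{Var}(X(0))>0$, then the correlation function $\rho_X(h)=\operatorname{Cor}(X(h),X(0))$ of $X$ is given by $$\rho_X(h)=\cosh(h^\top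 H)-2^{\,2\sum_{j=1}^d H_j-1}\prod_{k=1}^d\big|\sinh(h_k/2)\big|^{2H_k},\qquad h\in\mathbb{R}^d .$$ -/

import Mathlib

open MeasureTheory ProbabilityTheory

/-- A random field `X` indexed by `ℝ^d` is strictly stationary under `P`: all its finite-dimensional
distributions are invariant under translations of the parameter. -/
def IsStrictlyStationary {Ω : Type*} [MeasurableSpace Ω] {d : ℕ}
    (X : (Fin d → ℝ) → Ω → ℝ) (P : Measure Ω) : Prop :=
  ∀ (n : ℕ) (t : Fin n → Fin d → ℝ) (h : Fin d → ℝ),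
    IdentDistrib (fun ω i => X (t i + h) ω) (fun ω i => X (t i) ω) P P

/-- The generalised Lamperti transform with index `H`,
`Y(t) = (∏ j, t_j ^ H_j) X(log t_1, …, log t_d)`. It is meant for `t` in the positive orthant only;
every statement below is restricted to such `t`. -/
noncomputable def lampertiTransform {Ω : Type*} {d : ℕ} (H : Fin d → ℝ)
    (X : (Fin d → ℝ) → Ω → ℝ) (t : Fin d → ℝ) (ω : Ω) : ℝ :=
  (∏ j, t j ^ H j) * X (fun j => Real.log (t j)) ω

/-- A random field `Y` on the positive orthant has second-order translation-invariant increments: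
`E[(Y(t + h) - Y(t))²] = E[Y(h)²]` for all `t, h` in the positive orthant. -/
def HasSecondOrderTranslationInvariantIncrements {Ω : Type*} [MeasurableSpace Ω] {d : ℕ}
    (Y : (Fin d → ℝ) → Ω → ℝ) (P : Measure Ω) : Prop :=
  ∀ t h : Fin d → ℝ, (∀ j, 0 < t j) → (∀ j, 0 < h j) →
    ∫ ω, (Y (t + h) ω - Y t ω) ^ 2 ∂P = ∫ ω, (Y h ω) ^ 2 ∂P

/-- The correlation coefficient of two real random variables (meaningful when both variances
are positive). -/
noncomputable def correlation {Ω : Type*} [MeasurableSpace Ω] (U V : Ω → ℝ) (P : Measure Ω) : ℝ :=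
  covariance U V P / (Real.sqrt (variance U P) * Real.sqrt (variance V P))

/-- The correlation function `ρ_X(h) = Cor(X(h), X(0))` of a stationary random field `X`. -/
noncomputable def correlationFunction {Ω : Type*} [MeasurableSpace Ω] {d : ℕ}
    (X : (Fin d → ℝ) → Ω → ℝ) (P : Measure Ω) (h : Fin d → ℝ) : ℝ :=
  correlation (X h) (X 0) P

/-! Taking `t = 1` and increment `e^h - 1` in the hypothesis and expanding the square gives `E[X(h)
X(0)] = ρ(h) E[X(0)²]`, with `ρ` the candidate correlation, but only for `h` in the open positive
orthant. Two gaps remain: lags of mixed sign, and the mean, which is not assumed to vanish.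

Mixed signs occur only for `d ≥ 2`, where the field is degenerate: as one coordinate of `h` tends to
`0` the sinh product vanishes, while the cosh stays above `1`, against `E[X(h) X(0)] ≤ E[X(0)²]`.
The case `d = 0` is degenerate too.

For `d = 1`, symmetry covers all lags, and the mean is handled according to `H`. If `H < 1`, then
`ρ` decays, so averages of `X` over widely spaced points force the mean to be zero. If `H = 1`, then
`ρ = 1` and subtracting the squared mean is harmless. If `H > 1`, then `ρ` exceeds `1` somewhere and
the field vanishes. -/

/-- The candidate correlation function
`cosh (∑ j, h_j H_j) - 2 ^ (2 ∑ j, H_j - 1) ∏ k, |sinh (h_k / 2)| ^ (2 H_k)`. -/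
noncomputable def lampertiCorrelation {d : ℕ} (H h : Fin d → ℝ) : ℝ :=
  Real.cosh (∑ j, h j * H j)
    - (2 : ℝ) ^ (2 * (∑ j, H j) - 1) * ∏ k, |Real.sinh (h k / 2)| ^ (2 * H k)

/-! ### Hyperbolic form of the covariance bracket -/

lemma prod_rpow_two_mul {d : ℕ} (H : Fin d → ℝ) {u : Fin d → ℝ} (hu : ∀ j, 0 < u j) :
    ∏ j, u j ^ (2 * H j) = (∏ j, u j ^ H j) ^ 2 := by
  rw [← Finset.prod_pow]
  refine Finset.prod_congr rfl fun j _ => ?_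
  rw [mul_comm, Real.rpow_mul (hu j).le, Real.rpow_two]

/-- Factoring `√(xy)` out of `x - y` leaves `2 sinh` of half the logarithmic difference. -/
lemma abs_sub_rpow_eq_sinh {a x y : ℝ} (hx : 0 < x) (hy : 0 < y) :
    |x - y| ^ (2 * a) = (2 : ℝ) ^ (2 * a) * (x ^ a * y ^ a)
      * |Real.sinh ((Real.log x - Real.log y) / 2)| ^ (2 * a) := by
  have key : |x - y|
      = 2 * Real.exp ((Real.log x + Real.log y) / 2)
        * |Real.sinh ((Real.log x - Real.log y) / 2)| := by
    rw [← abs_of_pos (show (0 : ℝ) < 2 * Real.exp ((Real.log x + Real.log y) / 2) by positivity),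
      ← abs_mul, Real.sinh_eq]
    congr 1
    have h1 : Real.exp ((Real.log x + Real.log y) / 2)
        * Real.exp ((Real.log x - Real.log y) / 2) = x := by
      rw [← Real.exp_add, ← add_div]
      convert Real.exp_log hx using 2
      ring
    have h2 : Real.exp ((Real.log x + Real.log y) / 2)
        * Real.exp (-((Real.log x - Real.log y) / 2)) = y := by
      rw [← Real.exp_add]
      convert Real.exp_log hy using 2
      ring
    linear_combination -h1 + h2
  rw [key, Real.mul_rpow (by positivity) (abs_nonneg _), Real.mul_rpow (by norm_num) (by positivity),
    ← Real.exp_mul, Real.rpow_def_of_pos hx, Real.rpow_def_of_pos hy, ← Real.exp_add]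
  congr 3
  ring_nf

/-- The bracket of the covariance formula in terms of the correlation function. -/
lemma covariance_bracket_eq {d : ℕ} (H t s : Fin d → ℝ) (ht : ∀ j, 0 < t j) (hs : ∀ j, 0 < s j) :
    1 / 2 * ((∏ j, t j ^ (2 * H j)) + (∏ j, s j ^ (2 * H j)) - ∏ j, |t j - s j| ^ (2 * H j))
      = (∏ j, t j ^ H j) * (∏ j, s j ^ H j)
        * lampertiCorrelation H (fun j => Real.log (t j) - Real.log (s j)) := by
  have h1 : ∀ u : Fin d → ℝ, (∀ j, 0 < u j) →
      ∏ j, u j ^ H j = Real.exp (∑ j, Real.log (u j) * H j) := by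
    intro u hu
    rw [Real.exp_sum]
    exact Finset.prod_congr rfl fun j _ => Real.rpow_def_of_pos (hu j) _
  have h2 : ∏ j, |t j - s j| ^ (2 * H j)
      = 2 * (2 : ℝ) ^ (2 * (∑ j, H j) - 1) * ((∏ j, t j ^ H j) * (∏ j, s j ^ H j))
        * ∏ k, |Real.sinh ((Real.log (t k) - Real.log (s k)) / 2)| ^ (2 * H k) := by
    rw [Finset.prod_congr rfl fun j _ => abs_sub_rpow_eq_sinh (a := H j) (ht j) (hs j),
      Finset.prod_mul_distrib, Finset.prod_mul_distrib, Finset.prod_mul_distrib,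
      ← Real.rpow_sum_of_pos (by norm_num), ← Finset.mul_sum, Real.rpow_sub (by norm_num),
      Real.rpow_one]
    ring
  rw [prod_rpow_two_mul H ht, prod_rpow_two_mul H hs, h2, lampertiCorrelation]
  simp only [sub_mul, Finset.sum_sub_distrib]
  rw [h1 t ht, h1 s hs, Real.cosh_eq, neg_sub, Real.exp_sub, Real.exp_sub]
  field_simp

lemma lampertiCorrelation_neg {d : ℕ} (H h : Fin d → ℝ) :
    lampertiCorrelation H (-h) = lampertiCorrelation H h := by
  simp [lampertiCorrelation, neg_div, Real.sinh_neg]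

/-! ### Product moments of a stationary field -/

section Moments

variable {Ω : Type*} [MeasurableSpace Ω] {P : Measure Ω} {d : ℕ} {X : (Fin d → ℝ) → Ω → ℝ}

lemma IsStrictlyStationary.integral_mul (hX : IsStrictlyStationary X P) (u v : Fin d → ℝ) :
    ∫ ω, X u ω * X v ω ∂P = ∫ ω, X (u - v) ω * X 0 ω ∂P := by
  have h := (hX 2 ![u - v, 0] v).comp (u := fun x : Fin 2 → ℝ => x 0 * x 1) (by fun_prop)
  simpa [Function.comp_def] using h.integral_eq

lemma IsStrictlyStationary.integral_eq (hX : IsStrictlyStationary X P) (u : Fin d → ℝ) :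
    ∫ ω, X u ω ∂P = ∫ ω, X 0 ω ∂P := by
  have h := (hX 1 ![0] u).comp (u := fun x : Fin 1 → ℝ => x 0) (by fun_prop)
  simpa [Function.comp_def] using h.integral_eq

lemma IsStrictlyStationary.integral_sq (hX : IsStrictlyStationary X P) (u : Fin d → ℝ) :
    ∫ ω, X u ω ^ 2 ∂P = ∫ ω, X 0 ω ^ 2 ∂P := by
  simpa [sq] using hX.integral_mul u u

lemma IsStrictlyStationary.integral_mul_le (hX : IsStrictlyStationary X P)
    (hX2 : ∀ t, MemLp (X t) 2 P) (u v : Fin d → ℝ) :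
    ∫ ω, X u ω * X v ω ∂P ≤ ∫ ω, X 0 ω ^ 2 ∂P := by
  have h : ∫ ω, X u ω * X v ω ∂P ≤ ∫ ω, (1 / 2 * X u ω ^ 2 + 1 / 2 * X v ω ^ 2) ∂P := by
    refine integral_mono ((hX2 u).integrable_mul (hX2 v))
      (((hX2 u).integrable_sq.const_mul _).add ((hX2 v).integrable_sq.const_mul _)) fun ω => ?_
    show X u ω * X v ω ≤ 1 / 2 * X u ω ^ 2 + 1 / 2 * X v ω ^ 2
    nlinarith [sq_nonneg (X u ω - X v ω)]
  rw [integral_add ((hX2 u).integrable_sq.const_mul _) ((hX2 v).integrable_sq.const_mul _),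
    integral_const_mul, integral_const_mul, hX.integral_sq u, hX.integral_sq v] at h
  linarith

lemma IsStrictlyStationary.ae_eq_zero (hX : IsStrictlyStationary X P)
    (hX2 : ∀ t, MemLp (X t) 2 P) (h0 : ∫ ω, X 0 ω ^ 2 ∂P = 0) (u : Fin d → ℝ) :
    X u =ᵐ[P] 0 := by
  have h := (integral_eq_zero_iff_of_nonneg (fun ω => sq_nonneg (X u ω))
    (hX2 u).integrable_sq).1 ((hX.integral_sq u).trans h0)
  filter_upwards [h] with ω hω
  simpa using hω

/-- Polarisation: the product moments of `X` in the direction of the positive orthant. -/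
lemma integral_mul_eq_of_pos (hX : IsStrictlyStationary X P) (hX2 : ∀ t, MemLp (X t) 2 P)
    {H : Fin d → ℝ}
    (hY : HasSecondOrderTranslationInvariantIncrements (lampertiTransform H X) P)
    (h : Fin d → ℝ) (hh : ∀ j, 0 < h j) :
    ∫ ω, X h ω * X 0 ω ∂P = lampertiCorrelation H h * ∫ ω, X 0 ω ^ 2 ∂P := by
  have hpos : ∀ j, 0 < Real.exp (h j) - 1 := fun j => by
    have := Real.one_lt_exp_iff.2 (hh j)
    linarith
  -- Since `1 + (e^h - 1) = e^h`, the increment involves only `X(h)` and `X(0)`; stationarity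
  -- removes the point `log (e^h - 1)` from the right-hand side.
  have key := hY (fun _ => 1) (fun j => Real.exp (h j) - 1) (fun _ => one_pos) hpos
  have hbr := covariance_bracket_eq H (fun j => Real.exp (h j)) (fun _ => 1)
    (fun j => Real.exp_pos _) (fun _ => one_pos)
  have hadd : (fun _ => 1 : Fin d → ℝ) + (fun j => Real.exp (h j) - 1)
      = fun j => Real.exp (h j) := by
    ext j
    simp
  simp only [abs_of_pos (hpos _)] at hbr
  rw [prod_rpow_two_mul _ (fun j => Real.exp_pos _), prod_rpow_two_mul _ hpos] at hbr
  simp only [Real.log_exp, Real.log_one, sub_zero, Real.one_rpow, Finset.prod_const_one] at hbr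
  have ha : 0 < ∏ j, Real.exp (h j) ^ H j :=
    Finset.prod_pos fun j _ => Real.rpow_pos_of_pos (Real.exp_pos _) _
  rw [hadd] at key
  simp only [lampertiTransform, Real.log_exp, Real.log_one, Real.one_rpow,
    Finset.prod_const_one, one_mul, mul_pow] at key
  set a := ∏ j, Real.exp (h j) ^ H j
  set b := ∏ j, (Real.exp (h j) - 1) ^ H j
  rw [integral_const_mul, hX.integral_sq] at key
  have hexp : ∫ ω, (a * X h ω - X (fun _ => 0) ω) ^ 2 ∂P
      = a ^ 2 * ∫ ω, X h ω ^ 2 ∂P - 2 * a * ∫ ω, X h ω * X 0 ω ∂P + ∫ ω, X 0 ω ^ 2 ∂P := by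
    have hi1 : Integrable (fun ω => a ^ 2 * X h ω ^ 2) P := (hX2 h).integrable_sq.const_mul _
    have hi2 : Integrable (fun ω => 2 * a * (X h ω * X 0 ω)) P :=
      ((hX2 h).integrable_mul (hX2 0)).const_mul _
    have hi3 : Integrable (fun ω => a ^ 2 * X h ω ^ 2 - 2 * a * (X h ω * X 0 ω)) P := hi1.sub hi2
    rw [← integral_const_mul, ← integral_const_mul, ← integral_sub hi1 hi2,
      ← integral_add hi3 (hX2 0).integrable_sq]
    refine integral_congr_ae (.of_forall fun ω => ?_)
    show (a * X h ω - X 0 ω) ^ 2 = a ^ 2 * X h ω ^ 2 - 2 * a * (X h ω * X 0 ω) + X 0 ω ^ 2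
    ring
  rw [hexp, hX.integral_sq h] at key
  refine mul_left_cancel₀ ha.ne' ?_
  linear_combination (-1 / 2) * key + (∫ ω, X 0 ω ^ 2 ∂P) * hbr

/-- In dimension other than one the field is degenerate: for `d ≥ 2`, the product moments close to
a coordinate hyperplane would exceed the second moment. -/
lemma integral_sq_eq_zero_of_dim_ne_one (hX : IsStrictlyStationary X P)
    (hX2 : ∀ t, MemLp (X t) 2 P) {H : Fin d → ℝ} (hH : ∀ j, 0 < H j)
    (hY : HasSecondOrderTranslationInvariantIncrements (lampertiTransform H X) P) (hd : d ≠ 1) :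
    ∫ ω, X 0 ω ^ 2 ∂P = 0 := by
  have hM : 0 ≤ ∫ ω, X 0 ω ^ 2 ∂P := integral_nonneg fun ω => sq_nonneg _
  match d, hd with
  | 0, _ =>
    -- Positivity is vacuous here and the candidate equals `1 - 2⁻¹`, so the second moment is half
    -- of itself.
    have h := integral_mul_eq_of_pos hX hX2 hY 0 (fun j => j.elim0)
    simp only [lampertiCorrelation, Finset.univ_eq_empty, Finset.sum_empty, Finset.prod_empty,
      Real.cosh_zero, ← sq] at h
    norm_num [Real.rpow_neg_one] at h
    linarith
  | n + 2, _ =>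
    set p : ℝ → Fin (n + 2) → ℝ := fun ε => Fin.cons ε fun _ => 1
    have hcont : Continuous fun ε => lampertiCorrelation H (p ε) := by
      have hp : ∀ k, Continuous fun ε => p ε k := by
        intro k
        refine Fin.cases ?_ (fun k => ?_) k
        · simpa [p] using continuous_id'
        · simpa [p] using continuous_const
      unfold lampertiCorrelation
      refine (Real.continuous_cosh.comp (continuous_finsetSum _ fun k _ =>
        (hp k).mul continuous_const)).sub (continuous_const.mul
        (continuous_finsetProd _ fun k _ => ?_))
      exact (Real.continuous_sinh.comp ((hp k).div_const 2)).abs.rpow_const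
        fun _ => Or.inr (mul_pos two_pos (hH k)).le
    -- The moment formula is unavailable at `p 0`, which lies on the boundary of the orthant. The
    -- limit is taken in the explicit candidate, so no continuity of `X` is needed.
    have hlim : lampertiCorrelation H (p 0) * ∫ ω, X 0 ω ^ 2 ∂P ≤ ∫ ω, X 0 ω ^ 2 ∂P := by
      have ht : Filter.Tendsto (fun ε => lampertiCorrelation H (p ε) * ∫ ω, X 0 ω ^ 2 ∂P)
          (nhdsWithin 0 (Set.Ioi 0)) (nhds (lampertiCorrelation H (p 0) * ∫ ω, X 0 ω ^ 2 ∂P)) :=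
        ((hcont.mul continuous_const).tendsto 0).mono_left nhdsWithin_le_nhds
      refine le_of_tendsto ht ?_
      filter_upwards [self_mem_nhdsWithin] with ε hε
      rw [← integral_mul_eq_of_pos hX hX2 hY (p ε) ?_]
      · exact hX.integral_mul_le hX2 _ _
      · intro k
        refine Fin.cases ?_ (fun k => ?_) k
        · simpa [p] using hε
        · simp [p]
    have hval : 1 < lampertiCorrelation H (p 0) := by
      have h0 : ∏ k, |Real.sinh (p 0 k / 2)| ^ (2 * H k) = 0 := by
        refine Finset.prod_eq_zero (Finset.mem_univ 0) ?_
        simp [p, Real.zero_rpow (mul_pos two_pos (hH 0)).ne']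
      rw [lampertiCorrelation, h0, mul_zero, sub_zero, Real.one_lt_cosh]
      have : 0 < ∑ j, p 0 j * H j := by
        rw [Fin.sum_univ_succ]
        simp only [p, Fin.cons_zero, zero_mul, zero_add, Fin.cons_succ, one_mul]
        exact Finset.sum_pos (fun k _ => hH _) Finset.univ_nonempty
      exact this.ne'
    nlinarith

/-- If for every `ε > 0` there is a step `u` such that the product moments of a stationary field at
lags `u, 2 u, 3 u, …` are at most `ε`, then the field is centred. -/
lemma IsStrictlyStationary.integral_eq_zero_of_small [IsProbabilityMeasure P]
    (hX : IsStrictlyStationary X P) (hX2 : ∀ t, MemLp (X t) 2 P)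
    (hsmall : ∀ ε > 0, ∃ u : Fin d → ℝ, ∀ n : ℕ, 0 < n →
      ∫ ω, X ((n : ℝ) • u) ω * X 0 ω ∂P ≤ ε) :
    ∫ ω, X 0 ω ∂P = 0 := by
  set m := ∫ ω, X 0 ω ∂P
  set M := ∫ ω, X 0 ω ^ 2 ∂P
  have hM : 0 ≤ M := integral_nonneg fun ω => sq_nonneg _
  -- This is `(E S)² ≤ E[S²]` for a sum `S` of `n` values spaced by `u`: diagonal terms contribute
  -- at most `M` each, the others at most `ε`.
  have main : ∀ ε > 0, ∀ n : ℕ, (n : ℝ) ^ 2 * m ^ 2 ≤ n * M + (n : ℝ) ^ 2 * ε := by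
    intro ε hε n
    obtain ⟨u, hu⟩ := hsmall ε hε
    set S : Ω → ℝ := fun ω => ∑ i ∈ Finset.range n, X ((i : ℝ) • u) ω
    have hS : MemLp S 2 P := memLp_finsetSum _ fun i _ => hX2 _
    have hES : ∫ ω, S ω ∂P = n * m := by
      rw [integral_finsetSum _ fun i _ => (hX2 _).integrable (by norm_num)]
      simp [hX.integral_eq, m]
    have hES2 : ∫ ω, S ω ^ 2 ∂P ≤ n * M + (n : ℝ) ^ 2 * ε := by
      have hbound : ∀ i j : ℕ, ∫ ω, X ((i : ℝ) • u) ω * X ((j : ℝ) • u) ω ∂P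
          ≤ (if i = j then M else 0) + ε := by
        have hlt : ∀ i j : ℕ, j < i → ∫ ω, X ((i : ℝ) • u) ω * X ((j : ℝ) • u) ω ∂P ≤ ε := by
          intro i j hij
          rw [hX.integral_mul, ← sub_smul, ← Nat.cast_sub hij.le]
          exact hu _ (Nat.sub_pos_of_lt hij)
        intro i j
        rcases lt_trichotomy i j with h | h | h
        · rw [if_neg h.ne, zero_add]
          simpa only [mul_comm] using hlt j i h
        · rw [if_pos h]
          have := hX.integral_mul_le hX2 ((i : ℝ) • u) ((j : ℝ) • u)
          linarith
        · rw [if_neg h.ne', zero_add]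
          exact hlt i j h
      have hexp : ∫ ω, S ω ^ 2 ∂P = ∑ i ∈ Finset.range n, ∑ j ∈ Finset.range n,
          ∫ ω, X ((i : ℝ) • u) ω * X ((j : ℝ) • u) ω ∂P := by
        simp only [S, sq, Finset.sum_mul_sum]
        have hi : ∀ i j : ℕ, Integrable (fun ω => X ((i : ℝ) • u) ω * X ((j : ℝ) • u) ω) P :=
          fun i j => (hX2 _).integrable_mul (hX2 _)
        rw [integral_finsetSum _ fun i _ => integrable_finsetSum _ fun j _ => hi i j]
        exact Finset.sum_congr rfl fun i _ => integral_finsetSum _ fun j _ => hi i j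
      rw [hexp]
      refine (Finset.sum_le_sum fun i _ => Finset.sum_le_sum fun j _ => hbound i j).trans
        (le_of_eq ?_)
      simp only [Finset.sum_add_distrib, Finset.sum_ite_eq, Finset.sum_const, Finset.card_range,
        nsmul_eq_mul, Finset.sum_ite_mem, Finset.inter_self]
      ring
    have hvar := variance_nonneg S P
    rw [variance_eq_sub hS, hES] at hvar
    simp only [Pi.pow_apply] at hvar
    nlinarith
  by_contra hm
  have hm2 : 0 < m ^ 2 := by positivity
  -- With `ε = m² / 2` the bound becomes `n² m² / 2 ≤ n M`, which fails for this `n`.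
  obtain ⟨n, hn⟩ := exists_nat_gt (2 * M / m ^ 2)
  rw [div_lt_iff₀ hm2] at hn
  have hn0 : (0 : ℝ) < n := by
    by_contra h
    nlinarith
  nlinarith [main (m ^ 2 / 2) (by positivity) n]

end Moments

/-! ### Behaviour of the candidate in dimension one -/

/-- For `0 < H < 1` the one-dimensional correlation function decays. -/
lemma lampertiCorrelation_le {H h : Fin 1 → ℝ} (hH : 0 < H 0) (hH1 : H 0 < 1) (hh : 0 < h 0) :
    lampertiCorrelation H h ≤ Real.exp (-(H 0 * h 0)) + Real.exp (-((1 - H 0) * h 0)) := by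
  have hbr := covariance_bracket_eq H (fun j => Real.exp (h j)) (fun _ => 1)
    (fun j => Real.exp_pos _) (fun _ => one_pos)
  simp only [Fin.prod_univ_one, Real.one_rpow, Real.log_exp, Real.log_one, sub_zero,
    ← Real.exp_mul, mul_one] at hbr
  have hx : Real.exp (-h 0) < 1 := by simpa using hh
  have hfac : |Real.exp (h 0) - 1| = Real.exp (h 0) * (1 - Real.exp (-h 0)) := by
    rw [abs_of_pos (by simpa using hh), mul_sub, ← Real.exp_add]
    simp
  -- The base is at most `1` and `2 H ≤ 2`, so the power is at least `(1 - x)² ≥ 1 - 2 x` with `x =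
  -- e^(-h)`.
  have hle : 1 - 2 * Real.exp (-h 0) ≤ (1 - Real.exp (-h 0)) ^ (2 * H 0) := by
    have h1 := Real.rpow_le_rpow_of_exponent_ge (x := 1 - Real.exp (-h 0)) (y := 2) (z := 2 * H 0)
      (by linarith) (by linarith [Real.exp_pos (-h 0)]) (by linarith)
    rw [Real.rpow_two] at h1
    nlinarith [sq_nonneg (Real.exp (-h 0))]
  rw [hfac, Real.mul_rpow (Real.exp_pos _).le (by linarith), ← Real.exp_mul] at hbr
  have e1 : Real.exp (h 0 * (2 * H 0)) = Real.exp (h 0 * H 0) * Real.exp (h 0 * H 0) := by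
    rw [← Real.exp_add]
    ring_nf
  have e2 : Real.exp (h 0 * H 0) * Real.exp (-(H 0 * h 0)) = 1 := by
    rw [← Real.exp_add]
    simp [mul_comm]
  have e3 : Real.exp (-((1 - H 0) * h 0)) = Real.exp (h 0 * H 0) * Real.exp (-h 0) := by
    rw [← Real.exp_add]
    ring_nf
  have hE := Real.exp_pos (h 0 * H 0)
  refine le_of_mul_le_mul_left ?_ hE
  rw [← hbr, e3, mul_add, e2, e1]
  nlinarith [mul_le_mul_of_nonneg_left hle (mul_pos hE hE).le]

lemma lampertiCorrelation_eq_one {H : Fin 1 → ℝ} (hH : H 0 = 1) (h : Fin 1 → ℝ) :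
    lampertiCorrelation H h = 1 := by
  have hc : Real.cosh (h 0) = 2 * Real.sinh (h 0 / 2) ^ 2 + 1 := by
    have h1 := Real.cosh_two_mul (h 0 / 2)
    rw [mul_div_cancel₀ _ (two_ne_zero)] at h1
    linarith [Real.cosh_sq (h 0 / 2)]
  simp only [lampertiCorrelation, Fin.sum_univ_one, Fin.prod_univ_one, hH, mul_one, Real.rpow_two,
    sq_abs, hc]
  norm_num

/-! ### From product moments to covariances -/

section Covariance

variable {Ω : Type*} [MeasurableSpace Ω] {P : Measure Ω}

/-- In dimension one all product moments are determined. -/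
lemma integral_mul_eq_of_dim_one {X : (Fin 1 → ℝ) → Ω → ℝ} {H : Fin 1 → ℝ}
    (hX : IsStrictlyStationary X P) (hX2 : ∀ t, MemLp (X t) 2 P) (hH : 0 < H 0)
    (hY : HasSecondOrderTranslationInvariantIncrements (lampertiTransform H X) P)
    (h : Fin 1 → ℝ) :
    ∫ ω, X h ω * X 0 ω ∂P = lampertiCorrelation H h * ∫ ω, X 0 ω ^ 2 ∂P := by
  rcases lt_trichotomy (h 0) 0 with hn | h0 | hp
  · have h1 := integral_mul_eq_of_pos hX hX2 hY (-h) (fun j => by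
      rw [Subsingleton.elim j 0]; simpa using hn)
    have h2 := hX.integral_mul 0 h
    rw [zero_sub, h1, lampertiCorrelation_neg] at h2
    simpa only [mul_comm] using h2
  · have hz : h = 0 := by
      ext j
      rw [Subsingleton.elim j 0]
      exact h0
    subst hz
    simp [lampertiCorrelation, sq, Real.zero_rpow (mul_pos two_pos hH).ne']
  · exact integral_mul_eq_of_pos hX hX2 hY h (fun j => by rwa [Subsingleton.elim j 0])

/-- In dimension one, a field of index less than one is centred. -/
lemma integral_eq_zero_of_dim_one [IsProbabilityMeasure P] {X : (Fin 1 → ℝ) → Ω → ℝ} {H : Fin 1 → ℝ}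
    (hX : IsStrictlyStationary X P) (hX2 : ∀ t, MemLp (X t) 2 P) (hH : 0 < H 0) (hH1 : H 0 < 1)
    (hY : HasSecondOrderTranslationInvariantIncrements (lampertiTransform H X) P) :
    ∫ ω, X 0 ω ∂P = 0 := by
  set M := ∫ ω, X 0 ω ^ 2 ∂P
  have hM : 0 ≤ M := integral_nonneg fun ω => sq_nonneg _
  refine hX.integral_eq_zero_of_small hX2 fun ε hε => ?_
  have hexp : ∀ c : ℝ, 0 < c → Filter.Tendsto (fun x : ℝ => Real.exp (-(c * x)))
      Filter.atTop (nhds 0) := fun c hc =>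
    Real.tendsto_exp_neg_atTop_nhds_zero.comp (Filter.tendsto_id.const_mul_atTop hc)
  have hlim : Filter.Tendsto (fun x : ℝ =>
      (Real.exp (-(H 0 * x)) + Real.exp (-((1 - H 0) * x))) * M) Filter.atTop (nhds 0) := by
    simpa using ((hexp _ hH).add (hexp (1 - H 0) (by linarith))).mul_const M
  obtain ⟨x, hx, hx0⟩ := ((hlim.eventually (gt_mem_nhds hε)).and
    (Filter.eventually_gt_atTop 0)).exists
  -- The decay bound is decreasing, so one lag `x` with small bound controls all its multiples.
  refine ⟨fun _ => x, fun n hn => ?_⟩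
  have hn1 : (1 : ℝ) ≤ n := by exact_mod_cast hn
  have hnx : x ≤ n * x := by nlinarith
  rw [integral_mul_eq_of_pos hX hX2 hY _ fun j => by
    simp only [Pi.smul_apply, smul_eq_mul]
    linarith]
  refine le_trans (mul_le_mul_of_nonneg_right (lampertiCorrelation_le hH hH1 ?_) hM)
    (le_trans (mul_le_mul_of_nonneg_right ?_ hM) hx.le)
  · simp only [Pi.smul_apply, smul_eq_mul]
    linarith
  · simp only [Pi.smul_apply, smul_eq_mul]
    have := mul_le_mul_of_nonneg_left hnx hH.le
    have := mul_le_mul_of_nonneg_left hnx (sub_pos.2 hH1).le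
    gcongr

/-- In dimension one, an index larger than one forces the field to vanish. -/
lemma integral_sq_eq_zero_of_one_lt {X : (Fin 1 → ℝ) → Ω → ℝ} {H : Fin 1 → ℝ}
    (hX : IsStrictlyStationary X P) (hX2 : ∀ t, MemLp (X t) 2 P) (hH1 : 1 < H 0)
    (hY : HasSecondOrderTranslationInvariantIncrements (lampertiTransform H X) P) :
    ∫ ω, X 0 ω ^ 2 ∂P = 0 := by
  have hM : 0 ≤ ∫ ω, X 0 ω ^ 2 ∂P := integral_nonneg fun ω => sq_nonneg _
  -- At lag `log 2` the bracket compares the points `2` and `1`, whose difference is `1`; the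
  -- candidate is then `2^(H - 1) > 1`.
  have hr := integral_mul_eq_of_pos hX hX2 hY (fun _ => Real.log 2)
    (fun _ => Real.log_pos one_lt_two)
  have hle := hX.integral_mul_le hX2 (fun _ => Real.log 2) 0
  have hbr := covariance_bracket_eq H (fun _ => 2) (fun _ => 1) (fun _ => two_pos)
    (fun _ => one_pos)
  simp only [Fin.prod_univ_one, Real.one_rpow, Real.log_one, sub_zero, mul_one] at hbr
  norm_num at hbr
  rw [mul_comm 2 (H 0), Real.rpow_mul (by norm_num), Real.rpow_two] at hbr
  have h2 : (2 : ℝ) < 2 ^ H 0 := by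
    simpa using Real.rpow_lt_rpow_of_exponent_lt one_lt_two hH1
  have hK : 1 < lampertiCorrelation H fun _ => Real.log 2 := by nlinarith
  nlinarith

/-- Replacing moments by covariances subtracts `m²` on the left and `ρ m²` on the right, so it
requires `m = 0` or `ρ = 1`; in every remaining case the field is almost surely zero and both sides
vanish. -/
lemma covariance_eq_lampertiCorrelation_mul [IsProbabilityMeasure P]
    {d : ℕ} {X : (Fin d → ℝ) → Ω → ℝ} {H : Fin d → ℝ}
    (hX : IsStrictlyStationary X P) (hX2 : ∀ t, MemLp (X t) 2 P) (hH : ∀ j, 0 < H j)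
    (hY : HasSecondOrderTranslationInvariantIncrements (lampertiTransform H X) P)
    (u v : Fin d → ℝ) :
    covariance (X u) (X v) P = lampertiCorrelation H (u - v) * variance (X 0) P := by
  have hcov := covariance_eq_sub (hX2 u) (hX2 v)
  have hvar := variance_eq_sub (hX2 0)
  simp only [Pi.mul_apply, Pi.pow_apply] at hcov hvar
  have hdeg : ∫ ω, X 0 ω ^ 2 ∂P = 0 →
      covariance (X u) (X v) P = lampertiCorrelation H (u - v) * variance (X 0) P := by
    intro h0
    have hz := hX.ae_eq_zero hX2 h0
    have hm : ∫ ω, X 0 ω ∂P = 0 := by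
      rw [integral_congr_ae (hz 0)]
      simp
    have hp : ∫ ω, X u ω * X v ω ∂P = 0 := by
      rw [integral_eq_zero_of_ae]
      filter_upwards [hz u] with ω hω
      simp [hω]
    rw [hcov, hvar, hX.integral_eq u, hX.integral_eq v, hm, hp, h0]
    simp
  by_cases hd : d = 1
  swap
  · exact hdeg (integral_sq_eq_zero_of_dim_ne_one hX hX2 hH hY hd)
  subst hd
  rw [hX.integral_mul, integral_mul_eq_of_dim_one hX hX2 (hH 0) hY, hX.integral_eq u,
    hX.integral_eq v] at hcov
  rcases lt_trichotomy (H 0) 1 with hlt | heq | hgt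
  · rw [hcov, hvar, integral_eq_zero_of_dim_one hX hX2 (hH 0) hlt hY]
    ring
  · rw [hcov, hvar, lampertiCorrelation_eq_one heq]
    ring
  · exact hdeg (integral_sq_eq_zero_of_one_lt hX hX2 hgt hY)

end Covariance

theorem mainTheorem9 {Ω : Type*} [MeasurableSpace Ω] (P : Measure Ω) [IsProbabilityMeasure P]
    (d : ℕ) (H : Fin d → ℝ) (hH : ∀ j, 0 < H j)
    (X : (Fin d → ℝ) → Ω → ℝ)
    (hX_stat : IsStrictlyStationary X P)
    (hX_sq : ∀ t, MemLp (X t) 2 P)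
    (hY : HasSecondOrderTranslationInvariantIncrements (lampertiTransform H X) P) :
    (∀ t s : Fin d → ℝ, (∀ j, 0 < t j) → (∀ j, 0 < s j) →
      covariance (lampertiTransform H X t) (lampertiTransform H X s) P =
        1 / 2 * ((∏ j, t j ^ (2 * H j)) + (∏ j, s j ^ (2 * H j))
          - ∏ j, |t j - s j| ^ (2 * H j)) * variance (X 0) P) ∧
    (0 < variance (X 0) P → ∀ h : Fin d → ℝ,
      correlationFunction X P h =
        Real.cosh (∑ j, h j * H j)
          - (2 : ℝ) ^ (2 * (∑ j, H j) - 1) * ∏ k, |Real.sinh (h k / 2)| ^ (2 * H k)) := by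
  have hcov := covariance_eq_lampertiCorrelation_mul hX_stat hX_sq hH hY
  refine ⟨fun t s ht hs => ?_, fun hpos h => ?_⟩
  · rw [covariance_bracket_eq H t s ht hs]
    unfold lampertiTransform
    rw [covariance_const_mul_left, covariance_const_mul_right, hcov]
    simp only [Pi.sub_def]
    ring
  · have hvar : variance (X h) P = variance (X 0) P := by
      rw [variance_eq_sub (hX_sq h), variance_eq_sub (hX_sq 0), hX_stat.integral_eq h]
      simp only [Pi.pow_apply]
      rw [hX_stat.integral_sq h]
    rw [correlationFunction, correlation, hcov, hvar, Real.mul_self_sqrt hpos.le, sub_zero,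
      mul_div_cancel_right₀ _ hpos.ne', lampertiCorrelation]
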